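/- For elements $a,q$ of a commutative ring put $(a;q)_n=(1-a)(1-aq)\cdots(1-aq^{n-1})$, and let $F(q)=\sum_{n\ge 0}(q;q)_n$. For a nonzero integer $r$ define the $r$-Fishburn numbers $\xi_r(n)$ by the identity of formal power series $\sum_{n\ge 0}\xi_r(n)q^n=F((1-q)^r)$ in $\mathbb{Z}[[q]]$, and write $\xi(n)=\xi_1(n)$. For a prime $p\ge 5$, a nonzero integer $r$ relatively prime to $p$, and $0\le s\le p-1$, let $S^*(p,r,s)$ be the set of integers $j$ with $0\le j\le p-1$ such that $\tfrac12 rn(3n-1)\equiv j-s\pmod p$ for some integer $n$ and $24(j-s)\not\equiv -r\pmod p$. Let $T^*(p,r,s)$ be the set of integers $k$ with $0\le k\le p-1$ that are larger than every element of $S^*(p,r,s)$. Theorem. Suppose $p\ge 5$ is prime, $r$ is a nonzero integer relatively prime to $p$, and $0\le s\le p-1$. If $m\in T^*(p,r,s)$, then for all $n\ge 0$ $$\sum_{j=0}^{s}\binom{s}{j}(-1)^j\,\xi_r(pn+m-j)\equiv 0\pmod p.$$ In particular, $T^*(23,1,0)=\{18,19,20,21,22\}$, so that $\xi(23n+k)\equiv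 0\pmod{23}$ for all $n\ge 0$ and $18\le k\le 22$; and $T^*(5,-1,0)=\{4\}$, so that $\xi_{-1}(5n+4)\equiv 0\pmod 5$ for all $n\ge 0$. -/

import Mathlib

namespace Fishburn

open PowerSeries
open scoped PowerSeries.WithPiTopology

/-- The `q`-shifted factorial `(a; q)_n = (1 - a) (1 - a q) ⋯ (1 - a q ^ (n - 1))`. -/
def qPoch {R : Type*} [CommRing R] (a q : R) (n : ℕ) : R :=
  ∏ i ∈ Finset.range n, (1 - a * q ^ i)

/-- `F(x) = ∑ (x; x)_n`, an infinite sum of formal power series with integer coefficients.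
The topology on `ℤ⟦X⟧` is the usual one of formal power series (coefficientwise convergence,
where `ℤ` is discrete).  The sum converges whenever `x` has constant term `1`
(see `hasSum_F`). -/
noncomputable def F (x : ℤ⟦X⟧) : ℤ⟦X⟧ :=
  ∑' n : ℕ, qPoch x x n

/-- The power series `1 - q`, as a unit of `ℤ⟦X⟧` (its inverse is `1 + q + q ^ 2 + ⋯`). -/
noncomputable def oneSubX : ℤ⟦X⟧ˣ where
  val := 1 - X
  inv := PowerSeries.mk 1
  val_inv := by rw [mul_comm]; exact PowerSeries.mk_one_mul_one_sub_eq_one ℤ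
  inv_val := PowerSeries.mk_one_mul_one_sub_eq_one ℤ

/-- The `r`-Fishburn numbers: `∑ ξ_r(n) q ^ n = F((1 - q) ^ r)`, for an integer `r`. -/
noncomputable def xi (r : ℤ) (n : ℕ) : ℤ :=
  PowerSeries.coeff n (F ((oneSubX ^ r : ℤ⟦X⟧ˣ) : ℤ⟦X⟧))

/-- `S*(p, r, s)`: the residues `0 ≤ j ≤ p - 1` such that `r n (3 n - 1) / 2 ≡ j - s (mod p)`
for some integer `n`, and `24 (j - s) ≢ -r (mod p)`.
(The integer `n * (3 * n - 1)` is even, so the division is exact.) -/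
def Sstar (p : ℕ) (r : ℤ) (s : ℕ) : Set ℕ :=
  {j | j ≤ p - 1 ∧ (∃ n : ℤ, r * (n * (3 * n - 1) / 2) ≡ (j : ℤ) - (s : ℤ) [ZMOD (p : ℤ)]) ∧
    ¬ 24 * ((j : ℤ) - (s : ℤ)) ≡ -r [ZMOD (p : ℤ)]}

/-- `T*(p, r, s)`: the `0 ≤ k ≤ p - 1` that are larger than every element of `S*(p, r, s)`. -/
def Tstar (p : ℕ) (r : ℤ) (s : ℕ) : Set ℕ :=
  {k | k ≤ p - 1 ∧ ∀ j ∈ Sstar p r s, j < k}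

/-- `(x; x)_n` is divisible by `q ^ n` if `x` has constant term `1`. -/
theorem X_pow_dvd_qPoch {x : ℤ⟦X⟧} (hx : constantCoeff x = 1) (n : ℕ) :
    (X : ℤ⟦X⟧) ^ n ∣ qPoch x x n := by
  have h := Finset.prod_dvd_prod_of_dvd (s := Finset.range n) (fun _ => (X : ℤ⟦X⟧))
    (fun i => 1 - x * x ^ i) (fun i _ => by rw [PowerSeries.X_dvd_iff]; simp [hx])
  simpa [qPoch] using h

/-- The series defining `F x` converges if `x` has constant term `1`. -/
theorem hasSum_F {x : ℤ⟦X⟧} (hx : constantCoeff x = 1) :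
    HasSum (fun n : ℕ => qPoch x x n) (F x) := by
  refine Summable.hasSum ((PowerSeries.WithPiTopology.summable_iff_summable_coeff ℤ).2 fun d => ?_)
  refine summable_of_ne_finset_zero (s := Finset.range (d + 1)) fun n hn => ?_
  have hdn : d < n := by
    rw [Finset.mem_range] at hn
    omega
  exact (PowerSeries.X_pow_dvd_iff.1 (X_pow_dvd_qPoch hx n)) d hdn

/-- Each power `(1 - q) ^ r` has constant term `1`, so the series defining `ξ_r` converges. -/
theorem constantCoeff_oneSubX_zpow (r : ℤ) :
    constantCoeff ((oneSubX ^ r : ℤ⟦X⟧ˣ) : ℤ⟦X⟧) = 1 := by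
  have h1 : Units.map (constantCoeff (R := ℤ)).toMonoidHom oneSubX = 1 := by
    ext; simp [oneSubX]
  have h := map_zpow (Units.map (constantCoeff (R := ℤ)).toMonoidHom) oneSubX r
  rw [h1, one_zpow] at h
  have h2 := congrArg Units.val h
  rw [Units.coe_map] at h2
  exact h2

/-- The residue `s` always lies in `S*(p, r, s)`; hence `m ∈ T*(p, r, s)` implies `s < m`,
and `p n + m - j` is a true (nontruncated) difference of natural numbers for `0 ≤ j ≤ s`. -/
theorem lt_of_mem_Tstar {p : ℕ} (hp : p.Prime) {r : ℤ} (hr : IsCoprime r (p : ℤ)) {s : ℕ}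
    (hs : s ≤ p - 1) {m : ℕ} (hm : m ∈ Tstar p r s) : s < m := by
  refine hm.2 s ⟨hs, ⟨0, by simp⟩, fun h => ?_⟩
  have h2 : (p : ℤ) ∣ -r := by simpa using (Int.modEq_iff_dvd.1 h)
  have h3 : IsUnit (p : ℤ) := hr.isUnit_of_dvd' ((dvd_neg).1 h2) dvd_rfl
  exact (Nat.prime_iff_prime_int.1 hp).not_isUnit h3

end Fishburn

namespace Fishburn

open PowerSeries
open scoped PowerSeries.WithPiTopology

/-! ### Zagier's two-variable series and its truncated functional equation. -/

section Generic

variable {R : Type*} [CommRing R]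

/-! Work modulo `p` and `X ^ p ^ k`, with `y = (1 - X) ^ r`. Frobenius gives `y ^ p ^ k = 1`, while
`1 - y` is nilpotent, so `y` acts as a unipotent root of unity. There Zagier's strange identity is
exact (`neg_four_mul_sum_qPoch`): `-4 F(y)` is a signed sum of terms `c y ^ e` with `e` pentagonal
and `24 e + 1 = c ^ 2`. Let `j` be the residue of `s + r e` mod `p`. If `24 (j - s) ≡ -r`, then `p ∣
c` and the term vanishes. Otherwise `j ∈ Sstar p r s`, so `j < m`, and `(1 - X) ^ (s + r e)`, being
`(1 - X) ^ j` times a power of `1 - X ^ p`, has no coefficient at an index congruent to `m`. -/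

theorem qPoch_succ (a q : R) (n : ℕ) : qPoch a q (n + 1) = qPoch a q n * (1 - a * q ^ n) :=
  Finset.prod_range_succ _ _

theorem qPoch_succ' (a q : R) (n : ℕ) : qPoch a q (n + 1) = (1 - a) * qPoch (q * a) q n := by
  rw [qPoch, Finset.prod_range_succ', mul_comm, pow_zero, mul_one]
  refine congrArg _ (Finset.prod_congr rfl fun i _ => ?_)
  ring

theorem map_qPoch {S : Type*} [CommRing S] (f : R →+* S) (a q : R) (n : ℕ) :
    f (qPoch a q n) = qPoch (f a) (f q) n := by
  simp [qPoch, map_prod]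

/-- The partial sums of Zagier's two-variable series `∑ (x; q)_{n + 1} x ^ n`. -/
def zagierSum (q x : R) (N : ℕ) : R :=
  ∑ n ∈ Finset.range N, qPoch x q (n + 1) * x ^ n

/-- The last term is the exact truncation error; it disappears once `(q x; q)_N = 0`. -/
theorem zagierSum_add (q x : R) (N : ℕ) :
    zagierSum q x N + q ^ 2 * x ^ 3 * zagierSum q (q * x) N =
      1 - q * x ^ 2 + qPoch (q * x) q N * x ^ N * (q ^ (N + 1) * x ^ 2 - 1) := by
  induction N with
  | zero => simp [zagierSum, qPoch]
  | succ N ih =>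
    simp only [zagierSum] at ih ⊢
    rw [Finset.sum_range_succ, Finset.sum_range_succ]
    rw [qPoch_succ' x, qPoch_succ (q * x)]
    linear_combination ih

/-- The generalized pentagonal number `j (3 j + 1) / 2`. -/
def pent (j : ℕ) : ℕ := ∑ i ∈ Finset.range j, (3 * i + 2)

theorem pent_succ (j : ℕ) : pent (j + 1) = pent j + (3 * j + 2) := Finset.sum_range_succ _ _

theorem two_mul_pent (j : ℕ) : 2 * pent j = j * (3 * j + 1) := by
  induction j with
  | zero => simp [pent]
  | succ j ih => rw [pent_succ, mul_add, ih]; ring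

theorem dvd_pent {j : ℕ} (hj : Odd j) : j ∣ pent j := by
  have h : j ∣ 2 * pent j := ⟨_, two_mul_pent j⟩
  exact (Nat.Coprime.dvd_mul_left (by simpa using hj)).1 h

/-- If `(q x; q)_N` and its shifts vanish, the functional equation of `zagierSum` is exact, and
iterating it produces a partial theta function. -/
theorem zagierSum_eq_theta (q x : R) (N : ℕ) (h : ∀ j, qPoch (q ^ j * x) q N = 0) (K : ℕ) :
    zagierSum q x N = (∑ j ∈ Finset.range K, (-1) ^ j *
        (q ^ pent j * x ^ (3 * j) - q ^ (pent j + 2 * j + 1) * x ^ (3 * j + 2))) +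
      (-1) ^ K * q ^ pent K * x ^ (3 * K) * zagierSum q (q ^ K * x) N := by
  induction K with
  | zero => simp [pent]
  | succ K ih =>
    have h1 := zagierSum_add q (q ^ K * x) N
    have h2 : q * (q ^ K * x) = q ^ (K + 1) * x := by ring
    rw [h2, h (K + 1)] at h1
    rw [ih, Finset.sum_range_succ, pent_succ]
    have h3 : zagierSum q (q ^ K * x) N = 1 - q * (q ^ K * x) ^ 2 -
        q ^ 2 * (q ^ K * x) ^ 3 * zagierSum q (q ^ (K + 1) * x) N := by
      linear_combination h1
    rw [h3]
    ring

theorem qPoch_mem_pow (J : Ideal R) {q x : R} (hq : 1 - q ∈ J) (hx : 1 - x ∈ J) (N : ℕ) :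
    qPoch x q N ∈ J ^ N := by
  have key : ∀ i : ℕ, 1 - x * q ^ i ∈ J := fun i => by
    have h1 : Ideal.Quotient.mk J q = 1 := (Ideal.Quotient.eq.2 hq).symm
    have h2 : Ideal.Quotient.mk J x = 1 := (Ideal.Quotient.eq.2 hx).symm
    exact Ideal.Quotient.eq.1 (by simp [h1, h2])
  induction N with
  | zero => simp [qPoch]
  | succ N ih => rw [qPoch_succ, pow_succ]; exact Ideal.mul_mem_mul ih (key N)

end Generic

/-! ### The strange identity, by differentiating at `x = 1` with dual numbers. -/

open DualNumber in
/-- Zagier's strange identity at a unipotent `M`-th root of unity: a closed form of `∑ (q; q)_n`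
as a truncated partial theta function. -/
theorem neg_four_mul_sum_qPoch {R : Type*} [CommRing R] {M : ℕ} (hModd : Odd M) {q : R}
    (hqM : q ^ M = 1) (hq : (1 - q) ^ M = 0) {N : ℕ} (hN : M + 2 ≤ N) :
    -4 * ∑ n ∈ Finset.range N, qPoch q q n =
      ∑ j ∈ Finset.range M, (-1) ^ j * (((6 * j + 1 : ℕ) : R) * q ^ pent j -
        ((6 * j + 5 : ℕ) : R) * q ^ (pent j + 2 * j + 1)) := by
  let ι : R →+* R[ε] := TrivSqZeroExt.inlHom R R
  let J : Ideal R[ε] := Ideal.span {1 - ι q} ⊔ Ideal.span {ε}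
  -- Nilpotence replaces convergence: `M` factors `1 - q` or two factors `ε` already give zero,
  -- whence `M + 2`.
  have hJ : J ^ N = ⊥ := by
    rw [eq_bot_iff]
    calc J ^ N ≤ J ^ (M + 2) := Ideal.pow_le_pow_right hN
      _ ≤ Ideal.span {1 - ι q} ^ M ⊔ Ideal.span {ε} ^ 2 := Ideal.sup_pow_add_le_pow_sup_pow
      _ ≤ ⊥ := by
        have h1 : (1 - ι q) ^ M = 0 := by
          rw [← map_one ι, ← map_sub, ← map_pow, hq, map_zero]
        rw [Ideal.span_singleton_pow, Ideal.span_singleton_pow, h1, sq, DualNumber.eps_mul_eps]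
        simp
  have hq1 : 1 - ι q ∈ J := Ideal.mem_sup_left (Ideal.mem_span_singleton_self _)
  have hvan : ∀ j, qPoch (ι q ^ j * (1 + ε)) (ι q) N = 0 := fun j => by
    rw [← Ideal.mem_bot, ← hJ]
    refine qPoch_mem_pow J hq1 ?_ N
    have he : (ε : R[ε]) ∈ J := Ideal.mem_sup_right (Ideal.mem_span_singleton_self _)
    have h1 : Ideal.Quotient.mk J (ι q) = 1 := (Ideal.Quotient.eq.2 hq1).symm
    have h2 : Ideal.Quotient.mk J ε = 0 := Ideal.Quotient.eq_zero_iff_mem.2 he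
    exact Ideal.Quotient.eq.1 (by simp [h1, h2])
  have hpow : ∀ n : ℕ, (1 + ε : R[ε]) ^ n = 1 + (n : R[ε]) * (ε : R[ε]) := fun n => by
    induction n with
    | zero => simp
    | succ n ih =>
      rw [pow_succ, ih]; push_cast
      linear_combination (n : R[ε]) * DualNumber.eps_mul_eps (R := R)
  -- The factor `1 - x = -ε` splits off each summand, and `ε` sees only the value of the rest at `x
  -- = 1`.
  have hS : zagierSum (ι q) (1 + ε) N = - (ε * ι (∑ n ∈ Finset.range N, qPoch q q n)) := by
    have key : ∀ a : R[ε], ε * a = ε * ι a.fst := fun a => by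
      ext <;> simp [ι]
    have hι : ∀ a : R, (ι a).fst = a := fun a => rfl
    rw [zagierSum, map_sum, Finset.mul_sum, ← Finset.sum_neg_distrib]
    refine Finset.sum_congr rfl fun n _ => ?_
    have h1 : (1 : R[ε]) - (1 + ε) = -ε := by ring
    rw [qPoch_succ', h1, mul_assoc, neg_mul, key]
    congr 4
    have h2 := map_qPoch (TrivSqZeroExt.fstHom R R R : R[ε] →ₐ[R] R).toRingHom
      (ι q * (1 + ε)) (ι q) n
    simp only [AlgHom.toRingHom_eq_coe, RingHom.coe_coe, TrivSqZeroExt.fstHom_apply] at h2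
    simp [h2, hι]
  -- After `M` steps `q ^ M x = x`, so the same sum returns, with sign `-1` since `M` is odd: an
  -- equation to solve for it.
  have hth := zagierSum_eq_theta (ι q) (1 + ε) N hvan M
  obtain ⟨c, hc⟩ := dvd_pent hModd
  have hqM' : ι q ^ M = 1 := by rw [← map_pow, hqM, map_one]
  rw [hc, pow_mul, hqM', one_pow, one_mul, hModd.neg_one_pow, hS, mul_one] at hth
  simp only [hpow] at hth
  set f := ∑ n ∈ Finset.range N, qPoch q q n
  set A := ∑ j ∈ Finset.range M, (-1) ^ j * (q ^ pent j - q ^ (pent j + 2 * j + 1)) with hA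
  set B := ∑ j ∈ Finset.range M, (-1) ^ j *
    (((3 * j : ℕ) : R) * q ^ pent j - ((3 * j + 2 : ℕ) : R) * q ^ (pent j + 2 * j + 1)) with hB
  have hAB : ∑ j ∈ Finset.range M, (-1) ^ j *
      (ι q ^ pent j * (1 + ((3 * j : ℕ) : R[ε]) * ε) -
        ι q ^ (pent j + 2 * j + 1) * (1 + ((3 * j + 2 : ℕ) : R[ε]) * ε)) = ι A + ι B * ε := by
    rw [hA, hB, map_sum, map_sum, Finset.sum_mul, ← Finset.sum_add_distrib]
    refine Finset.sum_congr rfl fun j _ => ?_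
    simp only [map_mul, map_sub, map_pow, map_neg, map_one, map_natCast]
    ring
  rw [hAB] at hth
  have h1 := congrArg TrivSqZeroExt.fst hth
  have h2 := congrArg TrivSqZeroExt.snd hth
  simp [ι] at h1
  simp [ι] at h2
  have h3 : ∑ j ∈ Finset.range M, (-1) ^ j * (((6 * j + 1 : ℕ) : R) * q ^ pent j -
      ((6 * j + 5 : ℕ) : R) * q ^ (pent j + 2 * j + 1)) = A + 2 * B := by
    rw [hA, hB, Finset.mul_sum, ← Finset.sum_add_distrib]
    refine Finset.sum_congr rfl fun j _ => ?_
    push_cast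
    ring
  rw [h3]
  -- The `ε`-parts give `-2 f = B`; the constant parts give `A = 0`, so `A` may be added to complete
  -- the coefficients `6 j + 1` and `6 j + 5`.
  linear_combination h1 + 2 * h2

/-! ### Coefficients of powers of `1 - X` along a residue class. -/

theorem coeff_F {x : ℤ⟦X⟧} (hx : constantCoeff x = 1) {d N : ℕ} (h : d < N) :
    coeff d (F x) = coeff d (∑ n ∈ Finset.range N, qPoch x x n) := by
  have h1 := (hasSum_F hx).map (coeff (R := ℤ) d) (WithPiTopology.continuous_coeff ℤ d)
  have h2 := hasSum_sum_of_ne_finset_zero (L := .unconditional ℕ) (f := (coeff (R := ℤ) d) ∘ fun n => qPoch x x n)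
    (s := Finset.range N) fun n hn => by
      rw [Finset.mem_range] at hn
      exact (X_pow_dvd_iff.1 (X_pow_dvd_qPoch hx n)) d (by omega)
  rw [h1.unique h2, map_sum]
  rfl

theorem sum_choose_mul_coeff {R : Type*} [CommRing R] (f : R⟦X⟧) {s d : ℕ} (h : s ≤ d) :
    ∑ j ∈ Finset.range (s + 1), (s.choose j : R) * (-1) ^ j * coeff (d - j) f =
      coeff d ((1 - X) ^ s * f) := by
  have h1 : (1 - X : R⟦X⟧) ^ s =
      ∑ j ∈ Finset.range (s + 1), C ((s.choose j : R) * (-1) ^ j) * X ^ j := by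
    rw [sub_eq_neg_add, add_pow]
    refine Finset.sum_congr rfl fun j _ => ?_
    rw [neg_pow]
    simp only [one_pow, map_mul, map_pow, map_neg, map_one, map_natCast]
    ring
  rw [h1, Finset.sum_mul, map_sum]
  refine Finset.sum_congr rfl fun j hj => ?_
  rw [Finset.mem_range] at hj
  rw [mul_assoc (C _), coeff_C_mul, coeff_X_pow_mul', if_pos (by omega)]

/-- Multiplying by `1 - X ^ p` mixes only indices in one class mod `p`. The converse direction
serves negative exponents. -/
theorem coeff_one_sub_X_pow_mul {R : Type*} [CommRing R] {p m : ℕ} (hm : m < p) (f : R⟦X⟧) :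
    (∀ n, coeff (p * n + m) ((1 - X ^ p) * f) = 0) ↔ ∀ n, coeff (p * n + m) f = 0 := by
  have h0 : coeff (p * 0 + m) ((1 - X ^ p) * f) = coeff (p * 0 + m) f := by
    rw [sub_mul, one_mul, map_sub, coeff_X_pow_mul', if_neg (by omega), sub_zero]
  have h1 : ∀ n, coeff (p * (n + 1) + m) ((1 - X ^ p) * f) =
      coeff (p * (n + 1) + m) f - coeff (p * n + m) f := fun n => by
    have : p * (n + 1) + m = p * n + m + p := by ring
    rw [sub_mul, one_mul, map_sub, this, coeff_X_pow_mul]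
  constructor
  · intro h n
    induction n with
    | zero => rw [← h0, h]
    | succ n ih =>
      have h2 := h1 n
      rwa [h, ih, sub_zero, eq_comm] at h2
  · rintro h (_ | n)
    · rw [h0, h]
    · rw [h1, h, h, sub_zero]

theorem coeff_one_sub_X_pow {R : Type*} [CommRing R] {j d : ℕ} (h : j < d) :
    coeff d ((1 - X : R⟦X⟧) ^ j) = 0 := by
  have h1 : (1 - X : R⟦X⟧) ^ j = (((1 - Polynomial.X) ^ j : Polynomial R) : R⟦X⟧) := by simp
  rw [h1, Polynomial.coeff_coe]
  refine Polynomial.coeff_eq_zero_of_natDegree_lt (lt_of_le_of_lt ?_ h)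
  calc _ ≤ j * (1 - Polynomial.X : Polynomial R).natDegree := Polynomial.natDegree_pow_le
    _ ≤ j * 1 := Nat.mul_le_mul_left _ (by compute_degree)
    _ = j := mul_one j

/-- Modulo `p`, the coefficients of `(1 - X) ^ e` of index `m` mod `p` vanish if the residue of
`e` modulo `p` is less than `m`. -/
theorem coeff_one_sub_X_zpow {p : ℕ} [Fact p.Prime] {v : (ZMod p)⟦X⟧ˣ}
    (hv : (v : (ZMod p)⟦X⟧) = 1 - X) {e : ℤ} {j m : ℕ} (he : e ≡ j [ZMOD p]) (hjm : j < m)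
    (hm : m < p) (n : ℕ) : coeff (p * n + m) ((v ^ e : (ZMod p)⟦X⟧ˣ) : (ZMod p)⟦X⟧) = 0 := by
  obtain ⟨t, ht⟩ := he.symm.dvd
  obtain rfl : e = (p : ℤ) * t + j := by linarith
  rw [zpow_add, zpow_mul, zpow_natCast, zpow_natCast, Units.val_mul, Units.val_pow_eq_pow_val, hv]
  have hvp : ((v ^ p : (ZMod p)⟦X⟧ˣ) : (ZMod p)⟦X⟧) = 1 - X ^ p := by
    have := charP_of_injective_ringHom (C_injective (R := ZMod p)) p
    rw [Units.val_pow_eq_pow_val, hv, sub_pow_char, one_pow]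
  generalize v ^ p = w at hvp ⊢
  clear he ht
  revert n
  induction t using Int.induction_on with
  | zero => intro n; simpa using coeff_one_sub_X_pow (by omega)
  | succ t ih =>
    rwa [zpow_add_one, mul_comm (w ^ _), Units.val_mul, hvp, mul_assoc, coeff_one_sub_X_pow_mul hm]
  | pred t ih =>
    rw [← coeff_one_sub_X_pow_mul hm, ← hvp, ← mul_assoc, ← Units.val_mul, ← zpow_one_add]
    rwa [show (1 + (-(t : ℤ) - 1)) = -t by ring]

theorem mul_coeff_eq_zero {p : ℕ} [Fact p.Prime] {r : ℤ} (hr : IsCoprime r (p : ℤ)) {s m : ℕ}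
    (hm : m ∈ Tstar p r s) {v : (ZMod p)⟦X⟧ˣ} (hv : (v : (ZMod p)⟦X⟧) = 1 - X) {e c : ℕ} {t : ℤ}
    (he : t * (3 * t - 1) = 2 * e) (hc : 24 * e + 1 = c ^ 2) (n : ℕ) :
    (c : ZMod p) * coeff (p * n + m) ((1 - X) ^ s * ((v ^ r : (ZMod p)⟦X⟧ˣ) : (ZMod p)⟦X⟧) ^ e) =
      0 := by
  by_cases h : (c : ZMod p) = 0
  · rw [h, zero_mul]
  have hp : p.Prime := Fact.out
  have hp0 : (0 : ℤ) < p := by exact_mod_cast hp.pos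
  have hval : (1 - X) ^ s * ((v ^ r : (ZMod p)⟦X⟧ˣ) : (ZMod p)⟦X⟧) ^ e =
      ((v ^ (s + r * e : ℤ) : (ZMod p)⟦X⟧ˣ) : (ZMod p)⟦X⟧) := by
    rw [zpow_add, zpow_mul, zpow_natCast, zpow_natCast, Units.val_mul, Units.val_pow_eq_pow_val,
      Units.val_pow_eq_pow_val, hv]
  obtain ⟨j, hj⟩ := Int.eq_ofNat_of_zero_le (Int.emod_nonneg (s + r * e : ℤ) hp0.ne')
  have hjp : j < p := by exact_mod_cast hj ▸ Int.emod_lt_of_pos (s + r * e : ℤ) hp0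
  have hmod : (s + r * e : ℤ) ≡ j [ZMOD p] := by
    rw [← hj]; exact (Int.mod_modEq _ _).symm
  have hsub : r * e ≡ (j : ℤ) - s [ZMOD p] := by
    simpa using hmod.sub_right (s : ℤ)
  have hmp : m < p := by have := hm.1; have := hp.pos; omega
  rw [hval, coeff_one_sub_X_zpow hv hmod (hm.2 j ⟨by omega, ⟨t, ?_⟩, fun h24 => h ?_⟩) hmp, mul_zero]
  · rwa [he, Int.mul_ediv_cancel_left _ two_ne_zero]
  · have h1 : (p : ℤ) ∣ r * (c : ℤ) ^ 2 := by
      have h2 := ((hsub.mul_left 24).trans h24).symm.dvd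
      have h3 : (24 * e + 1 : ℤ) = (c : ℤ) ^ 2 := by exact_mod_cast hc
      rw [← h3]
      convert h2 using 1
      ring
    have h2 := (Nat.prime_iff_prime_int.1 hp).dvd_of_dvd_pow (hr.symm.dvd_of_dvd_mul_left h1)
    exact_mod_cast (ZMod.intCast_zmod_eq_zero_iff_dvd (c : ℤ) p).2 h2

/-! ### The congruence for the Fishburn numbers. -/

theorem X_pow_dvd_neg_four_mul_sum_qPoch_sub {p k : ℕ} [Fact p.Prime] (hp : Odd p) {r : ℤ}
    {v : (ZMod p)⟦X⟧ˣ} (hv : (v : (ZMod p)⟦X⟧) = 1 - X) {y : (ZMod p)⟦X⟧}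
    (hy : y = ((v ^ r : (ZMod p)⟦X⟧ˣ) : (ZMod p)⟦X⟧)) (hXy : X ∣ 1 - y) :
    X ^ p ^ k ∣ -4 * ∑ n ∈ Finset.range (p ^ k + 2), qPoch y y n -
      ∑ j ∈ Finset.range (p ^ k), (-1) ^ j * (((6 * j + 1 : ℕ) : (ZMod p)⟦X⟧) * y ^ pent j -
        ((6 * j + 5 : ℕ) : (ZMod p)⟦X⟧) * y ^ (pent j + 2 * j + 1)) := by
  have := charP_of_injective_ringHom (C_injective (R := ZMod p)) p
  rw [← Ideal.mem_span_singleton, ← Ideal.Quotient.mk_eq_mk_iff_sub_mem]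
  set π := Ideal.Quotient.mk (Ideal.span {(X : (ZMod p)⟦X⟧) ^ p ^ k})
  have hπX : π (X ^ p ^ k) = 0 :=
    Ideal.Quotient.eq_zero_iff_mem.2 (Ideal.mem_span_singleton_self _)
  have h1 : π y ^ p ^ k = 1 := by
    have hu : Units.map π.toMonoidHom (v ^ p ^ k) = 1 := by
      ext
      rw [Units.coe_map, Units.val_pow_eq_pow_val, hv, sub_pow_char_pow, one_pow]
      change π (1 - X ^ p ^ k) = 1
      rw [map_sub, hπX, map_one, sub_zero]
    have h2 : Units.map π.toMonoidHom ((v ^ r) ^ p ^ k) = 1 := by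
      rw [← zpow_natCast, zpow_comm, zpow_natCast, map_zpow, hu, one_zpow]
    have h3 := congrArg Units.val h2
    rw [Units.coe_map, Units.val_pow_eq_pow_val, ← hy] at h3
    rw [← map_pow]
    exact h3
  have h2 : (1 - π y) ^ p ^ k = 0 := by
    rw [← map_one π, ← map_sub, ← map_pow]
    exact Ideal.Quotient.eq_zero_iff_mem.2 (Ideal.mem_span_singleton.2 (pow_dvd_pow_of_dvd hXy _))
  have h4 : π 4 = 4 := map_ofNat π 4
  simpa only [map_sum, map_qPoch, map_mul, map_neg, map_sub, map_pow, map_one, map_natCast, h4]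
    using neg_four_mul_sum_qPoch hp.pow h1 h2 le_rfl

theorem sum_choose_mul_xi_modEq_zero {p : ℕ} {r : ℤ} {s m : ℕ} (hp : p.Prime) (hp5 : 5 ≤ p)
    (hr : IsCoprime r (p : ℤ)) (hs : s ≤ p - 1) (hm : m ∈ Tstar p r s) (n : ℕ) :
    ∑ j ∈ Finset.range (s + 1), (s.choose j : ℤ) * (-1) ^ j * xi r (p * n + m - j) ≡
      0 [ZMOD (p : ℤ)] := by
  have : Fact p.Prime := ⟨hp⟩
  have hodd : Odd p := hp.odd_of_ne_two (by omega)
  set d := p * n + m with hd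
  have hsd : s ≤ d := by have := lt_of_mem_Tstar hp hr hs hm; omega
  -- Precision `X ^ p ^ d` therefore suffices to read off coefficient `d`.
  have hdM : d < p ^ d := Nat.lt_pow_self hp.one_lt
  let φ : ℤ⟦X⟧ →+* (ZMod p)⟦X⟧ := PowerSeries.map (Int.castRingHom (ZMod p))
  let v := Units.map φ.toMonoidHom oneSubX
  have hv : (v : (ZMod p)⟦X⟧) = 1 - X := by
    change φ (1 - X) = 1 - X
    simp [φ]
  set x : ℤ⟦X⟧ := ((oneSubX ^ r : ℤ⟦X⟧ˣ) : ℤ⟦X⟧)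
  have hx : constantCoeff x = 1 := constantCoeff_oneSubX_zpow r
  have hy : φ x = ((v ^ r : (ZMod p)⟦X⟧ˣ) : (ZMod p)⟦X⟧) := by
    rw [← map_zpow]
    rfl
  have hXy : X ∣ 1 - φ x := by
    have h1 : X ∣ 1 - x := by rw [X_dvd_iff, map_sub, map_one, hx, sub_self]
    simpa [φ] using map_dvd φ h1
  have hxi : ∀ j, xi r (d - j) =
      coeff (d - j) (∑ n ∈ Finset.range (p ^ d + 2), qPoch x x n) := fun j =>
    coeff_F hx (by omega)
  simp only [hxi]
  rw [sum_choose_mul_coeff _ hsd, ← ZMod.intCast_eq_intCast_iff, Int.cast_zero]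
  have hcast : ((coeff d ((1 - X) ^ s * ∑ n ∈ Finset.range (p ^ d + 2), qPoch x x n) : ℤ) : ZMod p)
      = coeff d ((1 - X) ^ s * ∑ n ∈ Finset.range (p ^ d + 2), qPoch (φ x) (φ x) n) := by
    simp only [← map_qPoch, ← map_sum]
    have h1 : (1 - X : (ZMod p)⟦X⟧) = φ (1 - X) := by simp [φ]
    rw [h1, ← map_pow, ← map_mul, coeff_map]
    rfl
  rw [hcast]
  have hdvd := (X_pow_dvd_neg_four_mul_sum_qPoch_sub (k := d) hodd hv hy hXy).mul_left ((1 - X) ^ s)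
  have hcoeff := X_pow_dvd_iff.1 hdvd d hdM
  have hterm := fun (e c : ℕ) (t : ℤ) (he : t * (3 * t - 1) = 2 * e) (hc : 24 * e + 1 = c ^ 2) =>
    mul_coeff_eq_zero hr hm hv he hc n
  rw [← hy, ← hd] at hterm
  have hsum : coeff d ((1 - X) ^ s * ∑ j ∈ Finset.range (p ^ d), (-1) ^ j *
      (((6 * j + 1 : ℕ) : (ZMod p)⟦X⟧) * φ x ^ pent j -
        ((6 * j + 5 : ℕ) : (ZMod p)⟦X⟧) * φ x ^ (pent j + 2 * j + 1))) = 0 := by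
    rw [Finset.mul_sum, map_sum]
    refine Finset.sum_eq_zero fun j _ => ?_
    have hj := two_mul_pent j
    have hjZ : (2 * pent j : ℤ) = j * (3 * j + 1) := by exact_mod_cast hj
    -- The parameters `-j` and `j + 1` produce the two families of pentagonal exponents.
    have ha := hterm (pent j) (6 * j + 1) (-j) (by rw [hjZ]; ring) (by linear_combination 12 * hj)
    have hb := hterm (pent j + 2 * j + 1) (6 * j + 5) (j + 1)
      (by push_cast; linear_combination - hjZ) (by linear_combination 12 * hj)
    have hC : ∀ c : ℕ, (c : (ZMod p)⟦X⟧) = C (c : ZMod p) := fun c => (map_natCast C c).symm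
    have h1 : (1 - X) ^ s * ((-1) ^ j * (((6 * j + 1 : ℕ) : (ZMod p)⟦X⟧) * φ x ^ pent j -
        ((6 * j + 5 : ℕ) : (ZMod p)⟦X⟧) * φ x ^ (pent j + 2 * j + 1))) =
        C ((-1) ^ j) * (C ((6 * j + 1 : ℕ) : ZMod p) * ((1 - X) ^ s * φ x ^ pent j) -
          C ((6 * j + 5 : ℕ) : ZMod p) * ((1 - X) ^ s * φ x ^ (pent j + 2 * j + 1))) := by
      rw [hC, hC, map_pow, map_neg, map_one]
      ring
    rw [h1, coeff_C_mul, map_sub, coeff_C_mul, coeff_C_mul, ha, hb, sub_zero, mul_zero]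
  have h4C : (-4 : (ZMod p)⟦X⟧) = C (-4 : ZMod p) := by
    rw [map_neg]
    exact congrArg _ (map_ofNat C 4).symm
  rw [mul_sub, map_sub, hsum, sub_zero, mul_left_comm, h4C, coeff_C_mul] at hcoeff
  refine (mul_eq_zero.1 hcoeff).resolve_left fun h => ?_
  have h4 : p ∣ 2 ^ 2 := (ZMod.natCast_eq_zero_iff (2 ^ 2) p).1 (by
    push_cast
    linear_combination - h)
  have := Nat.le_of_dvd two_pos (hp.dvd_of_dvd_pow h4)
  omega

/-! ### The two explicit sets. -/

/-- A pentagonal residue `j` makes `24 r j + r ^ 2` the square of `r (6 n - 1)`. -/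
theorem exists_sq_of_mem_Sstar {p : ℕ} {r : ℤ} {s j : ℕ} (h : j ∈ Sstar p r s) :
    ∃ c : ZMod p, (r : ZMod p) * (24 * ((j : ZMod p) - s) + r) = c ^ 2 := by
  obtain ⟨-, ⟨n, hn⟩, -⟩ := h
  have h2 : 2 * (n * (3 * n - 1) / 2) = n * (3 * n - 1) := by
    refine Int.mul_ediv_cancel' ?_
    rcases Int.even_or_odd' n with ⟨t, rfl | rfl⟩
    · exact ⟨t * (3 * (2 * t) - 1), by ring⟩
    · exact ⟨(2 * t + 1) * (3 * t + 1), by ring⟩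
  have h3 := (ZMod.intCast_eq_intCast_iff _ _ p).2 hn
  have h4 := congrArg (Int.cast : ℤ → ZMod p) h2
  push_cast at h3 h4
  refine ⟨r * (6 * n - 1), ?_⟩
  linear_combination - 24 * (r : ZMod p) * h3 + 12 * (r : ZMod p) ^ 2 * h4

theorem Tstar_twentyThree : Tstar 23 1 0 = {18, 19, 20, 21, 22} := by
  have hub : ∀ j ∈ Sstar 23 1 0, j ≤ 17 := fun j hj => by
    obtain ⟨c, hc⟩ := exists_sq_of_mem_Sstar hj
    obtain ⟨h1, -, h3⟩ := hj
    by_contra! h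
    -- Here `24 j + 1 ≡ j + 1`, and 19, ..., 22 are nonresidues mod 23; `j = 22` is excluded by the
    -- second condition instead.
    have key : ∀ c : ZMod 23, c ^ 2 ≠ 19 ∧ c ^ 2 ≠ 20 ∧ c ^ 2 ≠ 21 ∧ c ^ 2 ≠ 22 := by decide
    obtain ⟨k1, k2, k3, k4⟩ := key c
    have : j = 18 ∨ j = 19 ∨ j = 20 ∨ j = 21 ∨ j = 22 := by omega
    rcases this with rfl | rfl | rfl | rfl | rfl
    · exact k1 (by rw [← hc]; decide)
    · exact k2 (by rw [← hc]; decide)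
    · exact k3 (by rw [← hc]; decide)
    · exact k4 (by rw [← hc]; decide)
    · exact h3 (by decide)
  -- `13 * 38 / 2 = 247 ≡ 17` mod 23.
  have h17 : 17 ∈ Sstar 23 1 0 := ⟨by norm_num, ⟨13, by decide⟩, by decide⟩
  ext k
  simp only [Tstar, Set.mem_ofPred_eq, Set.mem_insert_iff, Set.mem_singleton_iff]
  constructor
  · rintro ⟨h1, h2⟩
    have := h2 17 h17
    omega
  · intro h
    exact ⟨by omega, fun j hj => by have := hub j hj; omega⟩

theorem Tstar_five : Tstar 5 (-1) 0 = {4} := by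
  have hub : ∀ j ∈ Sstar 5 (-1) 0, j ≤ 3 := fun j hj => by
    obtain ⟨h1, -, h3⟩ := hj
    by_contra! h
    obtain rfl : j = 4 := by omega
    exact h3 (by decide)
  have hmem : 3 ∈ Sstar 5 (-1) 0 := ⟨by norm_num, ⟨-1, by decide⟩, by decide⟩
  ext k
  simp only [Tstar, Set.mem_ofPred_eq, Set.mem_singleton_iff]
  constructor
  · rintro ⟨h1, h2⟩
    have := h2 3 hmem
    omega
  · rintro rfl
    exact ⟨by omega, fun j hj => by have := hub j hj; omega⟩

end Fishburn

theorem mainTheorem1 :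
    (∀ (p : ℕ) (r : ℤ) (s m : ℕ), p.Prime → 5 ≤ p → r ≠ 0 → IsCoprime r (p : ℤ) →
      s ≤ p - 1 → m ∈ Fishburn.Tstar p r s →
      ∀ n : ℕ, ∑ j ∈ Finset.range (s + 1),
        (s.choose j : ℤ) * (-1) ^ j * Fishburn.xi r (p * n + m - j) ≡ 0 [ZMOD (p : ℤ)]) ∧
    Fishburn.Tstar 23 1 0 = {18, 19, 20, 21, 22} ∧
    (∀ n k : ℕ, 18 ≤ k → k ≤ 22 → Fishburn.xi 1 (23 * n + k) ≡ 0 [ZMOD 23]) ∧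
    Fishburn.Tstar 5 (-1) 0 = {4} ∧
    (∀ n : ℕ, Fishburn.xi (-1) (5 * n + 4) ≡ 0 [ZMOD 5]) := by
  have h23 : (23 : ℕ).Prime := by norm_num
  have h5 : (5 : ℕ).Prime := by norm_num
  refine ⟨fun p r s m hp hp5 _ hr hs hm n =>
    Fishburn.sum_choose_mul_xi_modEq_zero hp hp5 hr hs hm n, Fishburn.Tstar_twentyThree,
    fun n k hk hk' => ?_, Fishburn.Tstar_five, fun n => ?_⟩
  · have hm : k ∈ Fishburn.Tstar 23 1 0 := by
      rw [Fishburn.Tstar_twentyThree]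
      simp only [Set.mem_insert_iff, Set.mem_singleton_iff]
      omega
    simpa using Fishburn.sum_choose_mul_xi_modEq_zero h23 (by norm_num) isCoprime_one_left
      (by norm_num) hm n
  · have hm : 4 ∈ Fishburn.Tstar 5 (-1) 0 := by rw [Fishburn.Tstar_five]; rfl
    simpa using Fishburn.sum_choose_mul_xi_modEq_zero h5 le_rfl
      isCoprime_one_left.neg_left (by norm_num) hm n
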